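/- Throughout, $[g,h]=g^{-1}h^{-1}gh$, $G'=[G,G]$, $G_3=[G',G]$, $\Phi$ denotes the Frattini subgroup, $C_p$ is the cyclic group of order $p$, $F_p$ is the field with $p$ elements, and $$M_p(n,m,1)=\langle a,b,c \mid a^{p^n}=b^{p^m}=c^p=1,\ [a,b]=c,\ [c,a]=[c,b]=1\rangle .$$ Let $p>2$ be a prime and $n\ge m\ge 2$. Let $G$ be a finite $p$-group with $\Phi(G')\le G_3\cong C_p^2$, $G_3\le Z(G)$ and $G/G_3\cong M_p(n,m,1)$. Call $a,b\in G$ *characteristic generators* of $G$ if $G=\langle a,b,c\rangle$ with $c=[a,b]$, and some isomorphism $G/G_3\to M_p(n,m,1)$ sends the images of $a,b$ (hence also of $c$) to the standard generators of $M_p(n,m,1)$ of the same names. Put $x=[b,c]$ and $y=[c,a]$; then $G_3=\langle x,y\rangle$, and $$a^{p^n}=x^{w_{11}}y^{w_{12}},\qquad b^{p^m}=x^{w_{21}}y^{w_{22}},\qquad c^p=x^{w_{31}}y^{w_{32}}$$ with $w_{ij}\in F_p$. The matrix $w(G)=\begin{pmatrix} w_{11}&w_{12}\\ w_{21}&w_{22}\end{pmatrix}$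 and the vector $v(G)=\begin{pmatrix} w_{31}\\ w_{32}\end{pmatrix}$ are called a *characteristic matrix* and a *characteristic vector* of $G$ (with respect to $a,b$). **Theorem.** Let $p>2$ be a prime and $n\ge m\ge 2$, and let $G$ and $\bar G$ be two finite $p$-groups satisfying the above conditions with the same $p,n,m$. Let $w(G),v(G)$ be a characteristic matrix and vector of $G$ with respect to one choice of characteristic generators of $G$, and $w(\bar G),v(\bar G)$ a characteristic matrix and vector of $\bar G$ with respect to one choice of characteristic generators of $\bar G$. Then $G\cong\bar G$ if and only if there exist $y_{11},y_{12},y_{21},y_{22}\in F_p$ such that the matrix $$Y=\begin{pmatrix} y_{11}&y_{12}\\ y_{21}p^{n-m}&y_{22}\end{pmatrix}$$ over $F_p$ is invertible and, with $$Y_1=\begin{pmatrix} y_{11}&y_{12}p^{n-m}\\ y_{21}&y_{22}\end{pmatrix},$$ one has $$w(\bar G)=Y_1\,w(G)\,Y^{t}\qquad\text{and}\qquad v(\bar G)=Y\,v(G).$$ (Here $p^{n-m}$ is read in $F_p$: it is $1$ if $n=m$ and $0$ if $n>m$.) -/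

import Mathlib

/-- The commutator `[x, y] = x⁻¹ y⁻¹ x y` in the convention of the theory of `p`-groups
(Mathlib's `⁅x, y⁆` is `x y x⁻¹ y⁻¹`). -/
def pcomm {G : Type*} [Group G] (x y : G) : G := x⁻¹ * y⁻¹ * x * y

/-- The defining relators of `M_p(n,m,1)` in the free group on the three letters
`a = 0`, `b = 1`, `c = 2`:
`a ^ (p ^ n) = b ^ (p ^ m) = c ^ p = 1`, `[a, b] = c`, `[c, a] = [c, b] = 1`. -/
def MpRels (p n m : ℕ) : Set (FreeGroup (Fin 3)) :=
  {FreeGroup.of 0 ^ (p ^ n),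
   FreeGroup.of 1 ^ (p ^ m),
   FreeGroup.of 2 ^ p,
   pcomm (FreeGroup.of 0) (FreeGroup.of 1) * (FreeGroup.of 2)⁻¹,
   pcomm (FreeGroup.of 2) (FreeGroup.of 0),
   pcomm (FreeGroup.of 2) (FreeGroup.of 1)}

/-- The group `M_p(n,m,1)`, given by generators and relations. -/
abbrev Mp (p n m : ℕ) : Type := PresentedGroup (MpRels p n m)

/-- The third term `G₃` of the lower central series `G = G₁ ≥ G₂ = G' ≥ G₃ ≥ …`
(Mathlib numbers this series from `0`). -/
abbrev G3 (G : Type*) [Group G] : Subgroup G := (⊤ : Subgroup G).lowerCentralSeries 2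

/-- `Φ(G')`, the Frattini subgroup of the derived subgroup, as a subgroup of `G`. -/
def frattiniDerived (G : Type*) [Group G] : Subgroup G :=
  (frattini (commutator G)).map (commutator G).subtype

/-- `G` is a `p`-group with `Φ(G') ≤ G₃ ≅ C_p × C_p`, `G₃ ≤ Z(G)` and
`G / G₃ ≅ M_p(n,m,1)`. -/
structure IsCentralExtOfMp (p n m : ℕ) (G : Type*) [Group G] : Prop where
  isPGroup : IsPGroup p G
  frattini_le : frattiniDerived G ≤ G3 G
  G3_iso : Nonempty (G3 G ≃* Multiplicative (ZMod p) × Multiplicative (ZMod p))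
  G3_central : G3 G ≤ Subgroup.center G
  quotient_iso : Nonempty (G ⧸ G3 G ≃* Mp p n m)

/-- `a, b` is a set of characteristic generators of `G`: `G = ⟨a, b, c⟩` with `c = [a, b]`,
and the images of `a, b` (hence of `c`) in `G / G₃` are standard generators of
`M_p(n,m,1)`, that is, they satisfy its defining presentation. -/
def IsCharGenerators (p n m : ℕ) {G : Type*} [Group G] (a b : G) : Prop :=
  Subgroup.closure {a, b, pcomm a b} = ⊤ ∧
  ∃ f : G ⧸ G3 G ≃* Mp p n m,
    f (QuotientGroup.mk a) = PresentedGroup.of 0 ∧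
    f (QuotientGroup.mk b) = PresentedGroup.of 1

/-- `w` is a characteristic matrix of `G` and `v` a characteristic vector of `G`, both with
respect to one set `a, b` of characteristic generators: with `c = [a, b]`, `x = [b, c]` and
`y = [c, a]`,
`a ^ (p ^ n) = x ^ w₁₁ y ^ w₁₂`, `b ^ (p ^ m) = x ^ w₂₁ y ^ w₂₂`, `c ^ p = x ^ v₁ y ^ v₂`.
The exponents are residues modulo `p`; `x` and `y` lie in `G₃`, which has exponent `p` in the
groups considered, so the choice of representatives is immaterial. -/
def IsCharMatrixVector (p n m : ℕ) (G : Type*) [Group G]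
    (w : Matrix (Fin 2) (Fin 2) (ZMod p)) (v : Fin 2 → ZMod p) : Prop :=
  ∃ a b c x y : G, IsCharGenerators p n m a b ∧
    c = pcomm a b ∧ x = pcomm b c ∧ y = pcomm c a ∧
    a ^ (p ^ n) = x ^ (w 0 0).val * y ^ (w 0 1).val ∧
    b ^ (p ^ m) = x ^ (w 1 0).val * y ^ (w 1 1).val ∧
    c ^ p = x ^ (v 0).val * y ^ (v 1).val

open scoped commutatorElement

/-! The invariants change in a controlled way under a change of generators, and the relations they
encode determine the group once its order is known.

Put q = p^(n-m). Since G₃ is central, commutation G × G' → G₃ is bilinear, and G' = ⟨c⟩G₃ is abelian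
of exponent dividing p². Class-three collection then makes u ↦ u^(p^e) an endomorphism killing G'
for e ≥ 2 and p > 2. So for a' = a^i b^j d and b' = a^(kq) b^l e with d, e ∈ G', everything is
linear algebra in G₃ = ⟨x, y⟩ ≅ F_p². Let M = (i, j; kq, l), N = (i, jq; k, l) and D = det M. The
power relations of a', b' have rows N w in the basis x, y, and c' ≡ c^D modulo G₃ gives c'^p =
(c^p)^D. The new basis x', y' has coordinate rows D² M^(-t), so passing to it multiplies row vectors
by D^(-2) M^t. Hence w' = (D⁻¹N) w (D⁻¹M)^t and v' = D⁻¹M v, which is the stated rule with Y = D⁻¹M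
and Y₁ = D⁻¹N (`GenSystem.relations_iff`).

An isomorphism transports generators of one group to such a pair a', b' in the other: q divides the
exponent of a in b' because b'^(p^m) ∈ G₃ (`IsCharGenerators.pow_dvd`), and D ≠ 0 in F_p because x'
≠ 1. Conversely, from Y one recovers M = (det Y)⁻¹ Y, hence generators of G satisfying the relations
of the other group. These relations bound the order by p²|M_p(n,m,1)| (`card_le_of_relations`), the
common order of both groups. Applied to the subgroup of the direct product generated by the pairs of
corresponding generators, the bound makes both projections isomorphisms
(`nonempty_mulEquiv_of_relations`). -/

/-! ### Commutator calculus and collection of powers. -/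

theorem mul_eq_mul_mul_pcomm {G : Type*} [Group G] (x y : G) : x * y = y * x * pcomm x y := by
  simp [pcomm, mul_assoc]

theorem pcomm_eq_one_of_commute {G : Type*} [Group G] {x y : G} (h : Commute x y) :
    pcomm x y = 1 := by
  rw [pcomm, mul_assoc, h.eq]; group

theorem map_pcomm {G H F : Type*} [Group G] [Group H] [FunLike F G H] [MonoidHomClass F G H]
    (f : F) (x y : G) : f (pcomm x y) = pcomm (f x) (f y) := by
  simp [pcomm]

theorem inv_pcomm {G : Type*} [Group G] (x y : G) : (pcomm x y)⁻¹ = pcomm y x := by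
  simp [pcomm, mul_assoc]

/-- Commutation with a fixed `k` on the left factor, a homomorphism when its values are
central. -/
def pcommHom {G : Type*} [Group G] (k : G) (h : ∀ g, pcomm g k ∈ Subgroup.center G) :
    G →* G where
  toFun g := pcomm g k
  map_one' := by simp [pcomm]
  map_mul' u v := by
    have h1 := Subgroup.mem_center_iff.mp (h u) v⁻¹
    have h2 : pcomm (u * v) k = v⁻¹ * pcomm u k * (k⁻¹ * v * k) := by
      simp [pcomm, mul_assoc]
    rw [h2, h1]
    simp [pcomm, mul_assoc]

theorem pow_collect {G : Type*} [Group G] {u v d t : G} (hd : v * u = u * v * d)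
    (ht : d * v = v * d * t) (htc : t ∈ Subgroup.center G) (k : ℕ) :
    v ^ k * u = u * v ^ k * d ^ k * t ^ (k.choose 2) := by
  have st : ∀ g (j : ℕ), g * t ^ j = t ^ j * g := fun g j =>
    Subgroup.mem_center_iff.mp (pow_mem htc j) g
  have hdv : ∀ j : ℕ, d * v ^ j = v ^ j * d * t ^ j := by
    intro j
    induction j with
    | zero => simp
    | succ j ih =>
      rw [pow_succ, ← mul_assoc, ih, mul_assoc (v ^ j * d), ← st v j, ← mul_assoc,
        mul_assoc (v ^ j), ht, pow_succ', ← mul_assoc, ← mul_assoc, ← mul_assoc]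
  induction k with
  | zero => simp
  | succ k ih =>
    have : (k + 1).choose 2 = k + k.choose 2 := by
      rw [Nat.choose_succ_succ]; simp
    calc v ^ (k + 1) * u = v * (v ^ k * u) := by rw [pow_succ', mul_assoc]
      _ = (v * u) * v ^ k * d ^ k * t ^ (k.choose 2) := by rw [ih]; simp only [mul_assoc]
      _ = u * v * (d * v ^ k) * d ^ k * t ^ (k.choose 2) := by rw [hd]; simp only [mul_assoc]
      _ = u * v * v ^ k * d * (t ^ k * d ^ k) * t ^ (k.choose 2) := by
        rw [hdv]; simp only [mul_assoc]
      _ = _ := by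
        rw [← st, this, pow_add t k, pow_succ' v k, pow_succ' d k]; simp only [mul_assoc]

/-- Hall's collection formula when the commutators of d = [v, u] with u and v are central. The
binomial exponents are what the power maps below have to kill. -/
theorem mul_pow_collect {G : Type*} [Group G] {u v d s t : G} (hd : v * u = u * v * d)
    (hs : d * u = u * d * s) (ht : d * v = v * d * t)
    (hsc : s ∈ Subgroup.center G) (htc : t ∈ Subgroup.center G) (k : ℕ) :
    (u * v) ^ k = u ^ k * v ^ k * d ^ (k.choose 2) * s ^ (k.choose 3) *
      t ^ (k.choose 2 + 2 * k.choose 3) := by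
  have sc : ∀ g (j : ℕ), s ^ j * g = g * s ^ j := fun g j =>
    (Subgroup.mem_center_iff.mp (pow_mem hsc j) g).symm
  have tc : ∀ g (j : ℕ), t ^ j * g = g * t ^ j := fun g j =>
    (Subgroup.mem_center_iff.mp (pow_mem htc j) g).symm
  have hdx : ∀ (w r : G), r ∈ Subgroup.center G → d * w = w * d * r → ∀ j : ℕ,
      d ^ j * w = w * d ^ j * r ^ j := by
    intro w r hr h j
    have rc := Subgroup.mem_center_iff.mp hr
    induction j with
    | zero => simp
    | succ j ih =>
      have rcj := Subgroup.mem_center_iff.mp (pow_mem hr j)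
      rw [pow_succ', mul_assoc, ih, ← mul_assoc, ← mul_assoc, h, mul_assoc (w * d), ← rc,
        pow_succ' r]
      simp only [mul_assoc]
  induction k with
  | zero => simp
  | succ k ih =>
    have h2 : (k + 1).choose 2 = k + k.choose 2 := by
      rw [Nat.choose_succ_succ]; simp
    have h3 : (k + 1).choose 3 = k.choose 2 + k.choose 3 := by
      rw [Nat.choose_succ_succ]
    set B := k.choose 2
    set A := k.choose 3
    calc (u * v) ^ (k + 1) = u ^ k * v ^ k * d ^ B * (s ^ A * (t ^ (B + 2 * A) * (u * v))) := by
          rw [pow_succ, ih]; simp only [mul_assoc]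
      _ = u ^ k * v ^ k * (d ^ B * u) * v * s ^ A * t ^ (B + 2 * A) := by
          rw [tc, ← mul_assoc (s ^ A), sc (u * v)]; simp only [mul_assoc]
      _ = u ^ k * (v ^ k * u) * d ^ B * (s ^ B * v) * s ^ A * t ^ (B + 2 * A) := by
          rw [hdx u s hsc hs]; simp only [mul_assoc]
      _ = u ^ k * u * v ^ k * d ^ k * (t ^ B * (d ^ B * v * s ^ B * s ^ A * t ^ (B + 2 * A))) := by
          rw [pow_collect hd ht htc, sc]; simp only [mul_assoc]; rfl
      _ = u ^ (k + 1) * v ^ k * (d ^ (k + B) * v) * s ^ (B + A) * t ^ (B + 2 * A + B) := by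
          rw [tc, pow_succ u, pow_add d, pow_add s, pow_add t _ B]; simp only [mul_assoc]
      _ = u ^ (k + 1) * v ^ (k + 1) * d ^ (k + B) * (t ^ (k + B) * s ^ (B + A)) *
            t ^ (B + 2 * A + B) := by
          rw [hdx v t htc ht, pow_succ v]; simp only [mul_assoc]
      _ = _ := by
          rw [tc, h2, h3, show k + B + 2 * (B + A) = (k + B) + (B + 2 * A + B) by ring,
            pow_add t (k + B)]
          simp only [mul_assoc]

/-! ### Arithmetic of exponents. -/

/-- Divisibility by p² rather than p is needed because this is the exponent of an element of G',
whose order may be p². The factor 2 cancels as p is odd. -/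
theorem sq_dvd_choose_two {p e : ℕ} (hp : p.Prime) (h2 : 2 < p) (he : 2 ≤ e) :
    p ^ 2 ∣ (p ^ e).choose 2 := by
  have h : p ^ e ∣ (p ^ e).choose 2 * 2 := by
    rw [Nat.choose_two_right, Nat.div_mul_cancel (Nat.even_mul_pred_self _).two_dvd]
    exact dvd_mul_right _ _
  have hc : Nat.Coprime (p ^ 2) 2 :=
    Nat.Coprime.pow_left _ ((Nat.coprime_primes hp Nat.prime_two).2 (by omega))
  exact hc.dvd_of_dvd_mul_right ((pow_dvd_pow p he).trans h)

theorem dvd_choose_three {p e : ℕ} (hp : p.Prime) (h2 : 2 < p) (he : 2 ≤ e) :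
    p ∣ (p ^ e).choose 3 := by
  refine hp.dvd_choose_pow (by norm_num) ?_
  -- The case p = 3 is covered because e ≥ 2 gives p^e ≠ 3.
  have : p ^ 2 ≤ p ^ e := Nat.pow_le_pow_right hp.pos he
  nlinarith

theorem zpow_eq_zpow_of_cast_eq {G : Type*} [Group G] {p : ℕ} {x : G} (hx : x ^ p = 1)
    {i j : ℤ} (h : (i : ZMod p) = j) : x ^ i = x ^ j := by
  have hd : (orderOf x : ℤ) ∣ j - i :=
    (Int.natCast_dvd_natCast.2 (orderOf_dvd_of_pow_eq_one hx)).trans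
      ((ZMod.intCast_eq_intCast_iff_dvd_sub i j p).1 h)
  obtain ⟨r, hr⟩ := hd
  rw [show j = i + orderOf x * r by linarith, zpow_add, zpow_mul]
  simp [pow_orderOf_eq_one]

/-! ### The subgroups G' and G₃, and the power endomorphisms. -/

theorem pcomm_mem_commutator {G : Type*} [Group G] (g h : G) : pcomm g h ∈ commutator G := by
  have : pcomm g h = ⁅g⁻¹, h⁻¹⁆ := by simp [pcomm, commutatorElement_def]
  rw [this]
  exact Subgroup.commutator_mem_commutator (Subgroup.mem_top _) (Subgroup.mem_top _)

theorem commutatorElement_mem_G3 {G : Type*} [Group G] {d : G} (hd : d ∈ commutator G) (g : G) :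
    ⁅d, g⁆ ∈ G3 G :=
  Subgroup.commutator_mem_commutator hd (Subgroup.mem_top _)

theorem pcomm_mem_G3_left {G : Type*} [Group G] {d : G} (hd : d ∈ commutator G) (g : G) :
    pcomm d g ∈ G3 G := by
  have : pcomm d g = ⁅d⁻¹, g⁻¹⁆ := by simp [pcomm, commutatorElement_def]
  rw [this]
  exact commutatorElement_mem_G3 (inv_mem hd) _

theorem pcomm_mem_G3_right {G : Type*} [Group G] {d : G} (hd : d ∈ commutator G) (g : G) :
    pcomm g d ∈ G3 G := by
  rw [← inv_pcomm]
  exact inv_mem (pcomm_mem_G3_left hd g)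

theorem G3_le_commutator (G : Type*) [Group G] : G3 G ≤ commutator G :=
  (⊤ : Subgroup G).lowerCentralSeries_antitone (by norm_num : 1 ≤ 2)

/-- Generators `a, b` with the elements `c = [a, b]`, `x = [b, c]`, `y = [c, a]` of a group
whose `G₃` is central, of order `p ^ 2` and exponent `p`, and contains `c ^ p`. -/
structure GenSystem (p : ℕ) {G : Type*} [Group G] (a b c x y : G) : Prop where
  gen : Subgroup.closure {a, b, c} = ⊤
  c_eq : c = pcomm a b
  x_eq : x = pcomm b c
  y_eq : y = pcomm c a
  central : G3 G ≤ Subgroup.center G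
  pow_eq_one : ∀ z ∈ G3 G, z ^ p = 1
  card_G3 : Nat.card (G3 G) = p ^ 2
  c_pow : c ^ p ∈ G3 G

namespace GenSystem

variable {p : ℕ} {G : Type*} [Group G] {a b c x y : G}

theorem comm_of_mem (S : GenSystem p a b c x y) {z : G} (hz : z ∈ G3 G) (g : G) :
    Commute g z :=
  Subgroup.mem_center_iff.mp (S.central hz) g

theorem c_mem (S : GenSystem p a b c x y) : c ∈ commutator G := by
  rw [S.c_eq]; exact pcomm_mem_commutator _ _

theorem x_mem (S : GenSystem p a b c x y) : x ∈ G3 G := by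
  rw [S.x_eq]; exact pcomm_mem_G3_right S.c_mem _

theorem y_mem (S : GenSystem p a b c x y) : y ∈ G3 G := by
  rw [S.y_eq]; exact pcomm_mem_G3_left S.c_mem _

theorem exists_eq_mul_commutator (S : GenSystem p a b c x y) (g : G) :
    ∃ i j : ℤ, ∃ d ∈ commutator G, g = a ^ i * b ^ j * d := by
  have hc : (QuotientGroup.mk c : Abelianization G) = 1 :=
    (QuotientGroup.eq_one_iff c).2 S.c_mem
  have h : (Abelianization.of g) ∈ Subgroup.closure
      {Abelianization.of a, Abelianization.of b} := by
    have : g ∈ Subgroup.closure {a, b, c} := by rw [S.gen]; trivial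
    have h1 := Subgroup.mem_map_of_mem (Abelianization.of (G := G)) this
    rw [MonoidHom.map_closure] at h1
    refine (Subgroup.closure_le _).2 ?_ h1
    rintro _ ⟨u, hu, rfl⟩
    rcases hu with rfl | rfl | hu
    · exact Subgroup.subset_closure (by simp)
    · exact Subgroup.subset_closure (by simp)
    · have : u = c := hu
      subst this
      change (QuotientGroup.mk u : Abelianization G) ∈ _
      rw [hc]; exact one_mem _
  obtain ⟨i, j, hij⟩ := Subgroup.mem_closure_pair.1 h
  refine ⟨i, j, (a ^ i * b ^ j)⁻¹ * g, ?_, by group⟩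
  rw [← map_zpow, ← map_zpow, ← map_mul] at hij
  exact QuotientGroup.eq.1 hij

/-- The subgroup ⟨c⟩G₃ lies in G' and contains [G', G], so it is normal; modulo it the generators
commute, so the quotient is abelian. -/
theorem commutator_le (S : GenSystem p a b c x y) :
    commutator G ≤ Subgroup.zpowers c ⊔ G3 G := by
  set T := Subgroup.zpowers c ⊔ G3 G with hT
  have hTc : T ≤ commutator G :=
    sup_le (by rw [Subgroup.zpowers_le]; exact S.c_mem) (G3_le_commutator G)
  have hn : T.Normal := ⟨fun t ht g => by
    have h1 : ⁅t, g⁆ ∈ T := (le_sup_right : G3 G ≤ T) (commutatorElement_mem_G3 (hTc ht) g)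
    have : g * t * g⁻¹ = ⁅t, g⁆⁻¹ * t := by simp [commutatorElement_def, mul_assoc]
    rw [this]
    exact mul_mem (inv_mem h1) ht⟩
  rw [← Subgroup.Normal.quotient_commutative_iff_commutator_le]
  have hc : (QuotientGroup.mk c : G ⧸ T) = 1 :=
    (QuotientGroup.eq_one_iff c).2 ((le_sup_left : _ ≤ T) (Subgroup.mem_zpowers c))
  have hab : (QuotientGroup.mk a : G ⧸ T) * QuotientGroup.mk b =
      QuotientGroup.mk b * QuotientGroup.mk a := by
    rw [← QuotientGroup.mk_mul, mul_eq_mul_mul_pcomm, ← S.c_eq, QuotientGroup.mk_mul, hc, mul_one,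
      QuotientGroup.mk_mul]
  have htop : Subgroup.closure {(QuotientGroup.mk a : G ⧸ T), QuotientGroup.mk b,
      QuotientGroup.mk c} = ⊤ := by
    have := congrArg (Subgroup.map (QuotientGroup.mk' T)) S.gen
    rw [MonoidHom.map_closure, Subgroup.map_top_of_surjective _
      (QuotientGroup.mk'_surjective T)] at this
    simpa [Set.image_insert_eq, Set.image_singleton] using this
  have hcomm := Subgroup.isMulCommutative_closure
    (k := {(QuotientGroup.mk a : G ⧸ T), QuotientGroup.mk b, QuotientGroup.mk c}) (by
      simp only [Set.mem_insert_iff, Set.mem_singleton_iff]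
      rintro u (rfl | rfl | rfl) v (rfl | rfl | rfl) <;> simp [hc, hab])
  rw [htop] at hcomm
  exact ⟨⟨fun u v => by
    have := hcomm.is_comm.comm ⟨u, Subgroup.mem_top u⟩ ⟨v, Subgroup.mem_top v⟩
    exact congrArg Subtype.val this⟩⟩

theorem exists_eq_zpow_mul (S : GenSystem p a b c x y) {d : G} (hd : d ∈ commutator G) :
    ∃ k : ℤ, ∃ z ∈ G3 G, d = c ^ k * z := by
  have hd' := S.commutator_le hd
  rw [Subgroup.mem_sup_of_normal_right] at hd'
  obtain ⟨u, ⟨k, rfl⟩, z, hz, rfl⟩ := hd'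
  exact ⟨k, z, hz, rfl⟩

theorem commute_of_mem_commutator (S : GenSystem p a b c x y) {d e : G}
    (hd : d ∈ commutator G) (he : e ∈ commutator G) : Commute d e := by
  obtain ⟨k, z, hz, rfl⟩ := S.exists_eq_zpow_mul hd
  obtain ⟨l, w, hw, rfl⟩ := S.exists_eq_zpow_mul he
  refine Commute.mul_right (Commute.mul_left ?_ (S.comm_of_mem hz _).symm) (S.comm_of_mem hw _)
  exact (Commute.refl c).zpow_zpow _ _

theorem pow_sq_eq_one (S : GenSystem p a b c x y) {d : G} (hd : d ∈ commutator G) :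
    d ^ (p ^ 2) = 1 := by
  obtain ⟨k, z, hz, rfl⟩ := S.exists_eq_zpow_mul hd
  rw [(S.comm_of_mem hz (c ^ k)).mul_pow, sq, pow_mul z, S.pow_eq_one z hz, one_pow, mul_one,
    pow_mul, ← zpow_natCast (c ^ k) p, zpow_comm, zpow_natCast]
  exact S.pow_eq_one _ (zpow_mem S.c_pow k)

theorem pow_eq_one_of_mem (S : GenSystem p a b c x y) {d : G} (hd : d ∈ commutator G) {e : ℕ}
    (he : 2 ≤ e) : d ^ (p ^ e) = 1 := by
  obtain ⟨f, rfl⟩ := Nat.exists_eq_add_of_le he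
  rw [pow_add, pow_mul, S.pow_sq_eq_one hd, one_pow]

/-- In the collection formula the exponent of d is divisible by p² and those of the two central
commutators by p, so all correction terms vanish. -/
theorem mul_pow_prime_pow (S : GenSystem p a b c x y) (hp : p.Prime) (h2 : 2 < p) {e : ℕ}
    (he : 2 ≤ e) (u v : G) : (u * v) ^ (p ^ e) = u ^ (p ^ e) * v ^ (p ^ e) := by
  have hd : pcomm v u ∈ commutator G := pcomm_mem_commutator v u
  have hs := pcomm_mem_G3_left hd u
  have ht := pcomm_mem_G3_left hd v
  rw [mul_pow_collect (mul_eq_mul_mul_pcomm v u) (mul_eq_mul_mul_pcomm (pcomm v u) u)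
    (mul_eq_mul_mul_pcomm (pcomm v u) v) (S.central hs) (S.central ht)]
  obtain ⟨q, hq⟩ := sq_dvd_choose_two hp h2 he
  obtain ⟨r, hr⟩ := dvd_choose_three hp h2 he
  rw [hq, hr, pow_mul _ (p ^ 2), S.pow_sq_eq_one hd, pow_mul _ p, S.pow_eq_one _ hs,
    show p ^ 2 * q + 2 * (p * r) = p * (p * q + 2 * r) by ring, pow_mul _ p, S.pow_eq_one _ ht]
  simp

/-- `u ↦ u ^ (p ^ e)` is an endomorphism for `e ≥ 2`. -/
def powHom (S : GenSystem p a b c x y) (hp : p.Prime) (h2 : 2 < p) {e : ℕ} (he : 2 ≤ e) :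
    G →* G where
  toFun u := u ^ (p ^ e)
  map_one' := one_pow _
  map_mul' := S.mul_pow_prime_pow hp h2 he

theorem pow_prime_pow_eq (S : GenSystem p a b c x y) (hp : p.Prime) (h2 : 2 < p) {e : ℕ}
    (he : 2 ≤ e) (i j : ℤ) {d : G} (hd : d ∈ commutator G) :
    (a ^ i * b ^ j * d) ^ (p ^ e) = (a ^ (p ^ e)) ^ i * (b ^ (p ^ e)) ^ j := by
  have h : S.powHom hp h2 he (a ^ i * b ^ j * d) = S.powHom hp h2 he a ^ i *
      S.powHom hp h2 he b ^ j * S.powHom hp h2 he d := by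
    rw [map_mul, map_mul, map_zpow, map_zpow]
  exact h.trans (by rw [show S.powHom hp h2 he d = 1 from S.pow_eq_one_of_mem hd he, mul_one]; rfl)

end GenSystem

/-! ### Bilinearity of commutation with G', and coordinates on G₃. -/

theorem pcomm_zpow_right {G : Type*} [Group G] {g c : G} (h : Commute (pcomm g c) c) (k : ℤ) :
    pcomm g (c ^ k) = pcomm g c ^ k := by
  have h1 : pcomm g (c ^ k) = (g⁻¹ * c⁻¹ * g) ^ k * c ^ k := by
    have := conj_zpow (i := k) (a := g⁻¹) (b := c⁻¹)
    rw [inv_inv] at this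
    rw [this, inv_zpow]; rfl
  have h2 : g⁻¹ * c⁻¹ * g = pcomm g c * c⁻¹ := by simp [pcomm, mul_assoc]
  rw [h1, h2, h.inv_right.mul_zpow]
  simp

theorem pcomm_mul_right_of_mem_center {G : Type*} [Group G] {z : G} (g d : G)
    (hz : z ∈ Subgroup.center G) : pcomm g (d * z) = pcomm g d := by
  have h := Subgroup.mem_center_iff.mp hz
  calc pcomm g (d * z) = g⁻¹ * (z⁻¹ * d⁻¹ * g) * d * z := by simp [pcomm, mul_assoc]
    _ = _ := by
      rw [h]; simp [pcomm, mul_assoc]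
      rw [← mul_assoc z, ← h, mul_assoc]; simp

theorem zpow_mul_zpow_mul {G : Type*} [Group G] {x y : G} (h : Commute x y) (s t u v : ℤ) :
    x ^ s * y ^ t * (x ^ u * y ^ v) = x ^ (s + u) * y ^ (t + v) := by
  rw [mul_assoc, ← mul_assoc (y ^ t), ← (h.zpow_zpow u t).eq, zpow_add, zpow_add]
  simp only [mul_assoc]

theorem zpow_mul_zpow_zpow {G : Type*} [Group G] {x y : G} (h : Commute x y) (s t k : ℤ) :
    (x ^ s * y ^ t) ^ k = x ^ (s * k) * y ^ (t * k) := by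
  rw [(h.zpow_zpow s t).mul_zpow, zpow_mul, zpow_mul]

/-- The subgroup generated by two commuting elements. -/
def zpowPair {G : Type*} [Group G] (x y : G) (h : Commute x y) : Subgroup G where
  carrier := {g | ∃ s t : ℤ, g = x ^ s * y ^ t}
  one_mem' := ⟨0, 0, by simp⟩
  mul_mem' := by
    rintro _ _ ⟨s, t, rfl⟩ ⟨u, v, rfl⟩
    exact ⟨_, _, zpow_mul_zpow_mul h s t u v⟩
  inv_mem' := by
    rintro _ ⟨s, t, rfl⟩
    refine ⟨s * (-1), t * (-1), ?_⟩
    rw [← zpow_mul_zpow_zpow h, zpow_neg_one]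

namespace GenSystem

variable {p : ℕ} {G : Type*} [Group G] {a b c x y : G}

theorem commute_xy (S : GenSystem p a b c x y) : Commute x y := S.comm_of_mem S.y_mem x

/-- Commutation with c is a homomorphism, trivial on the abelian group G', with a ↦ y⁻¹ and b ↦ x.
-/
theorem pcomm_eq (S : GenSystem p a b c x y) (i j k : ℤ) {d z : G} (hd : d ∈ commutator G)
    (hz : z ∈ G3 G) : pcomm (a ^ i * b ^ j * d) (c ^ k * z) = x ^ (j * k) * y ^ (-(i * k)) := by
  have hcen : ∀ g, pcomm g c ∈ Subgroup.center G := fun g =>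
    S.central (pcomm_mem_G3_right S.c_mem g)
  rw [pcomm_mul_right_of_mem_center _ _ (S.central hz),
    pcomm_zpow_right (Subgroup.mem_center_iff.mp (hcen _) c).symm]
  have h : pcommHom c hcen (a ^ i * b ^ j * d) = pcommHom c hcen a ^ i *
      pcommHom c hcen b ^ j * pcommHom c hcen d := by
    rw [map_mul, map_mul, map_zpow, map_zpow]
  have ha : pcommHom c hcen a = y⁻¹ := by rw [S.y_eq, inv_pcomm]; rfl
  have hb : pcommHom c hcen b = x := S.x_eq.symm
  have hd' : pcommHom c hcen d = 1 :=
    pcomm_eq_one_of_commute (S.commute_of_mem_commutator hd S.c_mem)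
  have h' : pcomm (a ^ i * b ^ j * d) c = x ^ j * y ^ (-i) := by
    refine h.trans ?_
    rw [ha, hb, hd', mul_one, inv_zpow', (S.commute_xy.zpow_zpow j (-i)).eq]
  rw [h', zpow_mul_zpow_zpow S.commute_xy]
  ring_nf

theorem exists_eq_zpow_mul_zpow (S : GenSystem p a b c x y) {z : G} (hz : z ∈ G3 G) :
    ∃ s t : ℤ, z = x ^ s * y ^ t := by
  have hxy := S.commute_xy
  set N := zpowPair x y hxy
  suffices h : G3 G ≤ N from h hz
  refine Subgroup.commutator_le.2 fun d hd g _ => ?_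
  have : ⁅d, g⁆ = (pcomm g⁻¹ d⁻¹)⁻¹ := by simp [pcomm, commutatorElement_def, mul_assoc]
  rw [this]
  obtain ⟨i, j, e, he, hg⟩ := S.exists_eq_mul_commutator g⁻¹
  obtain ⟨k, w, hw, hk⟩ := S.exists_eq_zpow_mul (inv_mem hd)
  rw [hg, hk, S.pcomm_eq i j k he hw]
  exact inv_mem (show _ ∈ N from ⟨_, _, rfl⟩)

variable [Fact p.Prime]

theorem zpow_mul_zpow_congr (S : GenSystem p a b c x y) {s t u v : ℤ}
    (h1 : (s : ZMod p) = u) (h2 : (t : ZMod p) = v) : x ^ s * y ^ t = x ^ u * y ^ v := by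
  rw [zpow_eq_zpow_of_cast_eq (S.pow_eq_one x S.x_mem) h1,
    zpow_eq_zpow_of_cast_eq (S.pow_eq_one y S.y_mem) h2]

/-- The exponent map F_p² → G₃ is surjective between sets of p² elements, hence injective: x, y form
a basis. -/
theorem zpow_mul_zpow_inj (S : GenSystem p a b c x y) {s t u v : ℤ}
    (h : x ^ s * y ^ t = x ^ u * y ^ v) : (s : ZMod p) = u ∧ (t : ZMod p) = v := by
  have hmem : ∀ s t : ℤ, x ^ s * y ^ t ∈ G3 G := fun s t =>
    mul_mem (zpow_mem S.x_mem s) (zpow_mem S.y_mem t)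
  let φ : ZMod p × ZMod p → G3 G := fun q =>
    ⟨x ^ (q.1.val : ℤ) * y ^ (q.2.val : ℤ), hmem _ _⟩
  have hcast : ∀ s : ℤ, (((s : ZMod p).val : ℤ) : ZMod p) = s := fun s => by simp
  have hφ : ∀ s t : ℤ, (φ (s, t) : G) = x ^ s * y ^ t := fun s t =>
    S.zpow_mul_zpow_congr (hcast s) (hcast t)
  have hsurj : Function.Surjective φ := by
    rintro ⟨z, hz⟩
    obtain ⟨s, t, rfl⟩ := S.exists_eq_zpow_mul_zpow hz
    exact ⟨(s, t), Subtype.ext (hφ s t)⟩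
  have hcard : Nat.card (ZMod p × ZMod p) = Nat.card (G3 G) := by
    rw [S.card_G3, Nat.card_prod, Nat.card_zmod, sq]
  have hinj := ((Nat.bijective_iff_surjective_and_card φ).2 ⟨hsurj, hcard⟩).1
  have := hinj (a₁ := ((s : ZMod p), (t : ZMod p))) (a₂ := ((u : ZMod p), (v : ZMod p)))
    (Subtype.ext (by rw [hφ, hφ, h]))
  exact ⟨congrArg Prod.fst this, congrArg Prod.snd this⟩

end GenSystem

/-! ### Change of generators. -/

/-- In class two the commutator is alternating and bilinear, so a determinant appears. It is used in
G/G₃. -/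
theorem pcomm_of_class_two {Q : Type*} [Group Q] (h : ∀ g k : Q, pcomm g k ∈ Subgroup.center Q)
    (a b : Q) (i j k l : ℤ) {d e : Q} (hd : d ∈ Subgroup.center Q)
    (he : e ∈ Subgroup.center Q) :
    pcomm (a ^ i * b ^ j * d) (a ^ k * b ^ l * e) = pcomm a b ^ (i * l - j * k) := by
  have key : ∀ (i j : ℤ) (d g : Q), d ∈ Subgroup.center Q →
      pcomm (a ^ i * b ^ j * d) g = pcomm a g ^ i * pcomm b g ^ j := by
    intro i j d g hd
    have : pcommHom g (fun u => h u g) (a ^ i * b ^ j * d) = pcommHom g (fun u => h u g) a ^ i *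
        pcommHom g (fun u => h u g) b ^ j * pcommHom g (fun u => h u g) d := by
      rw [map_mul, map_mul, map_zpow, map_zpow]
    refine this.trans ?_
    rw [show pcommHom g (fun u => h u g) d = 1 from
      pcomm_eq_one_of_commute (Subgroup.mem_center_iff.mp hd g).symm, mul_one]
    rfl
  have ha : pcomm a (a ^ k * b ^ l * e) = pcomm a b ^ l := by
    rw [← inv_pcomm, key k l e a he, pcomm_eq_one_of_commute (Commute.refl a), one_zpow, one_mul,
      ← inv_zpow, inv_pcomm]
  have hb : pcomm b (a ^ k * b ^ l * e) = pcomm a b ^ (-k) := by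
    rw [← inv_pcomm, key k l e b he, pcomm_eq_one_of_commute (Commute.refl b), one_zpow, mul_one,
      zpow_neg]
  rw [key i j d _ hd, ha, hb, ← zpow_mul, ← zpow_mul, ← zpow_add]
  ring_nf

theorem mk_mem_center_of_mem_commutator {G : Type*} [Group G] {d : G} (hd : d ∈ commutator G) :
    (QuotientGroup.mk d : G ⧸ G3 G) ∈ Subgroup.center (G ⧸ G3 G) := by
  refine Subgroup.mem_center_iff.mpr fun g => ?_
  obtain ⟨g, rfl⟩ := QuotientGroup.mk_surjective g
  rw [← QuotientGroup.mk_mul, ← QuotientGroup.mk_mul, mul_eq_mul_mul_pcomm g d,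
    QuotientGroup.mk_mul (G3 G) (d * g) (pcomm g d), (QuotientGroup.eq_one_iff _).2
    (pcomm_mem_G3_right hd g), mul_one]

theorem mk_pcomm_mem_center {G : Type*} [Group G] (g k : G ⧸ G3 G) :
    pcomm g k ∈ Subgroup.center (G ⧸ G3 G) := by
  obtain ⟨g, rfl⟩ := QuotientGroup.mk_surjective g
  obtain ⟨k, rfl⟩ := QuotientGroup.mk_surjective k
  exact mk_mem_center_of_mem_commutator (pcomm_mem_commutator g k)

theorem mul_zpow_mul_zpow_neg {A : Type*} [CommGroup A] (u v : A) (i j k l : ℤ) :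
    (u ^ i * v ^ j) ^ l * (u ^ k * v ^ l) ^ (-j) = u ^ (i * l - j * k) := by
  rw [mul_zpow, mul_zpow, ← zpow_mul, ← zpow_mul, ← zpow_mul, ← zpow_mul, mul_mul_mul_comm,
    ← zpow_add, ← zpow_add, show j * l + l * -j = 0 by ring, zpow_zero, mul_one]
  ring_nf

theorem mem_of_zpow_mem {G : Type*} [Group G] {p : ℕ} (hG : IsPGroup p G) {D : ℤ}
    (hD : IsCoprime D p) {S : Subgroup G} {g : G} (hg : g ^ D ∈ S) : g ∈ S := by
  obtain ⟨N, hN⟩ := hG g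
  obtain ⟨u, v, huv⟩ : IsCoprime D ((p : ℤ) ^ N) := hD.pow_right
  have : g = (g ^ D) ^ u := by
    rw [← zpow_mul, show D * u = 1 + ((p ^ N : ℕ) : ℤ) * (-v) by push_cast; linarith, zpow_add,
      zpow_mul _ ((p ^ N : ℕ) : ℤ), zpow_natCast, hN]
    simp
  rw [this]
  exact zpow_mem hg u

namespace GenSystem

variable {p : ℕ} {G : Type*} [Group G] {a b c x y : G}

theorem exists_pcomm_eq (S : GenSystem p a b c x y) (i j k l : ℤ) {d e : G}
    (hd : d ∈ commutator G) (he : e ∈ commutator G) :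
    ∃ z ∈ G3 G, pcomm (a ^ i * b ^ j * d) (a ^ k * b ^ l * e) = c ^ (i * l - j * k) * z := by
  refine ⟨(c ^ (i * l - j * k))⁻¹ * pcomm (a ^ i * b ^ j * d) (a ^ k * b ^ l * e), ?_,
    by group⟩
  have := pcomm_of_class_two mk_pcomm_mem_center (QuotientGroup.mk a : G ⧸ G3 G)
    (QuotientGroup.mk b) i j k l (mk_mem_center_of_mem_commutator hd)
    (mk_mem_center_of_mem_commutator he)
  refine QuotientGroup.eq.1 ?_
  rw [S.c_eq]
  exact this.symm

/-- Effect of a change of generators `a' = a ^ i * b ^ j * d`, `b' = a ^ k * b ^ l * e` with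
`d, e ∈ G'` on the derived elements. -/
theorem change (S : GenSystem p a b c x y) {i j k l D : ℤ} (hD : D = i * l - j * k)
    {d e a' b' c' : G} (hd : d ∈ commutator G) (he : e ∈ commutator G)
    (ha' : a' = a ^ i * b ^ j * d) (hb' : b' = a ^ k * b ^ l * e) (hc' : c' = pcomm a' b') :
    (∃ z ∈ G3 G, c' = c ^ D * z) ∧ c' ^ p = (c ^ p) ^ D ∧
      pcomm b' c' = x ^ (l * D) * y ^ (-(k * D)) ∧
      pcomm c' a' = x ^ (-(j * D)) * y ^ (i * D) := by
  obtain ⟨z, hz, h⟩ := S.exists_pcomm_eq i j k l hd he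
  rw [← ha', ← hb', ← hc', ← hD] at h
  refine ⟨⟨z, hz, h⟩, ?_, ?_, ?_⟩
  · rw [h, (S.comm_of_mem hz _).mul_pow, S.pow_eq_one z hz, mul_one, ← zpow_natCast, zpow_comm,
      zpow_natCast]
  · rw [h, hb', S.pcomm_eq k l D he hz]
  · rw [← inv_pcomm, h, ha', S.pcomm_eq i j D hd hz, ← zpow_neg_one,
      zpow_mul_zpow_zpow S.commute_xy]
    ring_nf

/-- With D invertible modulo p, roots of D-th powers can be taken inside a subgroup of a p-group.
Cramer's rule recovers x and y from the new commutators, then c modulo G₃, then a and b modulo G'.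
-/
theorem closure_pair_eq_top (S : GenSystem p a b c x y) (hG : IsPGroup p G) {i j k l D : ℤ}
    (hD : D = i * l - j * k) (hDp : IsCoprime D p)
    {d e a' b' : G} (hd : d ∈ commutator G) (he : e ∈ commutator G)
    (ha' : a' = a ^ i * b ^ j * d) (hb' : b' = a ^ k * b ^ l * e) :
    Subgroup.closure {a', b'} = ⊤ := by
  set T := Subgroup.closure {a', b'}
  have hT : ∀ {u v : G}, u ∈ T → v ∈ T → pcomm u v ∈ T := fun hu hv =>
    mul_mem (mul_mem (mul_mem (inv_mem hu) (inv_mem hv)) hu) hv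
  have haT : a' ∈ T := Subgroup.subset_closure (by simp)
  have hbT : b' ∈ T := Subgroup.subset_closure (by simp)
  obtain ⟨⟨z, hz, hc⟩, -, hX, hY⟩ := S.change hD hd he ha' hb' rfl
  have hcT := hT haT hbT
  have hXT := hT hbT hcT
  have hYT := hT hcT haT
  have hxy := S.commute_xy
  rw [hX] at hXT
  rw [hY] at hYT
  have hD2 : IsCoprime (D * D) p := hDp.mul_left hDp
  have hxT : x ∈ T := by
    refine mem_of_zpow_mem hG hD2 ?_
    -- The exponents i, k are the Cramer coefficients that eliminate y and leave x^(D²).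
    have := mul_mem (zpow_mem hXT i) (zpow_mem hYT k)
    rw [zpow_mul_zpow_zpow hxy, zpow_mul_zpow_zpow hxy, zpow_mul_zpow_mul hxy,
      show l * D * i + -(j * D) * k = D * D by rw [hD]; ring,
      show -(k * D) * i + i * D * k = 0 by ring, zpow_zero, mul_one] at this
    exact this
  have hyT : y ∈ T := by
    refine mem_of_zpow_mem hG hD2 ?_
    have := mul_mem (zpow_mem hXT j) (zpow_mem hYT l)
    rw [zpow_mul_zpow_zpow hxy, zpow_mul_zpow_zpow hxy, zpow_mul_zpow_mul hxy,
      show l * D * j + -(j * D) * l = 0 by ring,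
      show -(k * D) * j + i * D * l = D * D by rw [hD]; ring, zpow_zero, one_mul] at this
    exact this
  have h3 : G3 G ≤ T := fun z hz => by
    obtain ⟨s, t, rfl⟩ := S.exists_eq_zpow_mul_zpow hz
    exact mul_mem (zpow_mem hxT s) (zpow_mem hyT t)
  have hcT' : c ∈ T := by
    refine mem_of_zpow_mem hG hDp ?_
    rw [hc] at hcT
    exact (Subgroup.mul_mem_cancel_right T (h3 hz)).1 hcT
  have h2 : commutator G ≤ T := fun u hu => by
    obtain ⟨r, z, hz, rfl⟩ := S.exists_eq_zpow_mul hu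
    exact mul_mem (zpow_mem hcT' r) (h3 hz)
  have hof : ∀ {d}, d ∈ commutator G → (QuotientGroup.mk d : Abelianization G) = 1 := fun hd =>
    (QuotientGroup.eq_one_iff _).2 hd
  have mem_of : ∀ {u v : G}, v ∈ T → (QuotientGroup.mk v : Abelianization G) = QuotientGroup.mk u →
      u ∈ T := fun {u v} hv h => by
    have := mul_mem hv (h2 (QuotientGroup.eq.1 h))
    simpa using this
  have ha1 : (Abelianization.of a' : Abelianization G) =
      Abelianization.of a ^ i * Abelianization.of b ^ j := by
    rw [ha', map_mul, map_mul, map_zpow, map_zpow, show Abelianization.of d = 1 from hof hd,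
      mul_one]
  have hb1 : (Abelianization.of b' : Abelianization G) =
      Abelianization.of a ^ k * Abelianization.of b ^ l := by
    rw [hb', map_mul, map_mul, map_zpow, map_zpow, show Abelianization.of e = 1 from hof he,
      mul_one]
  have haT' : a ∈ T := by
    refine mem_of_zpow_mem hG hDp
      (mem_of (mul_mem (zpow_mem haT l) (zpow_mem hbT (-j))) ?_)
    change Abelianization.of (a' ^ l * b' ^ (-j)) = Abelianization.of (a ^ D)
    rw [map_mul, map_zpow, map_zpow, map_zpow, ha1, hb1, mul_zpow_mul_zpow_neg, hD]
  have hbT' : b ∈ T := by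
    refine mem_of_zpow_mem hG hDp
      (mem_of (mul_mem (zpow_mem hbT i) (zpow_mem haT (-k))) ?_)
    change Abelianization.of (b' ^ i * a' ^ (-k)) = Abelianization.of (b ^ D)
    rw [map_mul, map_zpow, map_zpow, map_zpow, ha1, hb1, mul_comm (_ ^ k) (_ ^ l),
      mul_comm (_ ^ i) (_ ^ j),
      mul_zpow_mul_zpow_neg, hD]
    ring_nf
  rw [eq_top_iff, ← S.gen, Subgroup.closure_le]
  rintro u (rfl | rfl | hu)
  · exact haT'
  · exact hbT'
  · rw [Set.mem_singleton_iff.1 hu]; exact hcT'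

end GenSystem

/-! ### An order bound from the relations. -/

/-- The subgroup ⟨x, y⟩ is central with at most p² elements, and modulo it the relations become
those of M_p(n,m,1). -/
theorem card_le_of_relations {K : Type*} [Group K] [Finite K] {p n m : ℕ} [Fact p.Prime]
    [Finite (Mp p n m)] {a b c x y : K} (gen : Subgroup.closure {a, b} = ⊤)
    (hc : c = pcomm a b) (hx : x = pcomm b c) (hy : y = pcomm c a)
    (hxc : x ∈ Subgroup.center K) (hyc : y ∈ Subgroup.center K) (hxp : x ^ p = 1)
    (hyp : y ^ p = 1) {s₁ t₁ s₂ t₂ s₃ t₃ : ℤ} (ha : a ^ (p ^ n) = x ^ s₁ * y ^ t₁)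
    (hb : b ^ (p ^ m) = x ^ s₂ * y ^ t₂) (hcp : c ^ p = x ^ s₃ * y ^ t₃) :
    Nat.card K ≤ p ^ 2 * Nat.card (Mp p n m) := by
  have hxy : Commute x y := Subgroup.mem_center_iff.mp hyc x
  set N := zpowPair x y hxy
  have hNc : N ≤ Subgroup.center K := by
    rintro _ ⟨s, t, rfl⟩
    exact mul_mem (zpow_mem hxc s) (zpow_mem hyc t)
  have hN : N.Normal := ⟨fun u hu g => by
    rw [Subgroup.mem_center_iff.mp (hNc hu) g, mul_inv_cancel_right]; exact hu⟩
  have hNcard : Nat.card N ≤ p ^ 2 := by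
    let φ : ZMod p × ZMod p → N := fun q =>
      ⟨x ^ (q.1.val : ℤ) * y ^ (q.2.val : ℤ), _, _, rfl⟩
    have hsurj : Function.Surjective φ := by
      rintro ⟨_, s, t, rfl⟩
      refine ⟨(s, t), Subtype.ext ?_⟩
      exact congrArg₂ _ (zpow_eq_zpow_of_cast_eq hxp (by simp))
        (zpow_eq_zpow_of_cast_eq hyp (by simp))
    have := Nat.card_le_card_of_surjective φ hsurj
    rwa [Nat.card_prod, Nat.card_zmod, ← sq] at this
  have hmk : ∀ s t : ℤ, (QuotientGroup.mk (x ^ s * y ^ t) : K ⧸ N) = 1 := fun s t =>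
    (QuotientGroup.eq_one_iff _).2 ⟨s, t, rfl⟩
  let f : Fin 3 → K ⧸ N := ![QuotientGroup.mk a, QuotientGroup.mk b, QuotientGroup.mk c]
  have hmkc : ∀ u v : K, pcomm (QuotientGroup.mk u : K ⧸ N) (QuotientGroup.mk v) =
      QuotientGroup.mk (pcomm u v) := fun u v => rfl
  have hf : ∀ r ∈ MpRels p n m, FreeGroup.lift f r = 1 := by
    rintro r (rfl | rfl | rfl | rfl | rfl | rfl)
    · simp only [map_pow, FreeGroup.lift_apply_of]
      exact (congrArg QuotientGroup.mk ha).trans (hmk _ _)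
    · simp only [map_pow, FreeGroup.lift_apply_of]
      exact (congrArg QuotientGroup.mk hb).trans (hmk _ _)
    · simp only [map_pow, FreeGroup.lift_apply_of]
      exact (congrArg QuotientGroup.mk hcp).trans (hmk _ _)
    · simp only [map_mul, map_inv, map_pcomm, FreeGroup.lift_apply_of]
      change pcomm (QuotientGroup.mk a : K ⧸ N) (QuotientGroup.mk b) * (QuotientGroup.mk c)⁻¹ = 1
      rw [hmkc, ← hc, mul_inv_cancel]
    · simp only [map_pcomm, FreeGroup.lift_apply_of]
      change pcomm (QuotientGroup.mk c : K ⧸ N) (QuotientGroup.mk a) = 1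
      rw [hmkc, ← hy]
      simpa using hmk 0 1
    · simp only [map_pcomm, FreeGroup.lift_apply_of]
      change pcomm (QuotientGroup.mk c : K ⧸ N) (QuotientGroup.mk b) = 1
      rw [← inv_pcomm, hmkc, ← hx]
      simpa using hmk 1 0
  have hsurj : Function.Surjective (PresentedGroup.toGroup hf) := by
    rw [← MonoidHom.range_eq_top, eq_top_iff,
      ← Subgroup.map_top_of_surjective _ (QuotientGroup.mk'_surjective N), ← gen,
      MonoidHom.map_closure, Subgroup.closure_le]
    rintro _ ⟨u, rfl | hu, rfl⟩
    · exact ⟨PresentedGroup.of 0, PresentedGroup.toGroup.of hf⟩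
    · rw [Set.mem_singleton_iff.1 hu]
      exact ⟨PresentedGroup.of 1, PresentedGroup.toGroup.of hf⟩
  rw [Subgroup.card_eq_card_quotient_mul_card_subgroup N, mul_comm]
  exact Nat.mul_le_mul hNcard (Nat.card_le_card_of_surjective _ hsurj)

/-! ### The transformation rule for the matrix and the vector. -/

/-- The coefficient matrix is D times an adjugate, with D = il - jk, so its inverse is D⁻² times the
original matrix; here u = D⁻¹. -/
theorem solve_pair_iff {R : Type*} [CommRing R] {i j k l u : R} (hu : u * (i * l - j * k) = 1)
    (L M s t : R) :
    (L = l * (i * l - j * k) * s + -(j * (i * l - j * k)) * t ∧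
      M = -(k * (i * l - j * k)) * s + i * (i * l - j * k) * t) ↔
    (s = u ^ 2 * (i * L + j * M) ∧ t = u ^ 2 * (k * L + l * M)) := by
  have hu2 : u ^ 2 * (i * l - j * k) ^ 2 = 1 := by rw [← mul_pow, hu, one_pow]
  constructor
  · rintro ⟨rfl, rfl⟩
    exact ⟨by linear_combination -s * hu2, by linear_combination -t * hu2⟩
  · rintro ⟨rfl, rfl⟩
    exact ⟨by linear_combination -L * hu2, by linear_combination -M * hu2⟩

namespace GenSystem

variable {p : ℕ} {G : Type*} [Group G] {a b c x y : G} [Fact p.Prime]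

theorem zpow_mul_zpow_iff (S : GenSystem p a b c x y) {s t u v : ℤ} :
    x ^ s * y ^ t = x ^ u * y ^ v ↔ (s : ZMod p) = u ∧ (t : ZMod p) = v :=
  ⟨S.zpow_mul_zpow_inj, fun h => S.zpow_mul_zpow_congr h.1 h.2⟩

theorem zpow_eq_change_iff (S : GenSystem p a b c x y) {i j k l D : ℤ} (hD : D = i * l - j * k)
    {x' y' : G} (hx' : x' = x ^ (l * D) * y ^ (-(k * D)))
    (hy' : y' = x ^ (-(j * D)) * y ^ (i * D)) {u : ZMod p}
    (hu : u * ((i : ZMod p) * l - j * k) = 1) (L M : ℤ) (s t : ZMod p) :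
    x ^ L * y ^ M = x' ^ s.val * y' ^ t.val ↔
      s = u ^ 2 * (i * L + j * M) ∧ t = u ^ 2 * (k * L + l * M) := by
  have hxy := S.commute_xy
  rw [← zpow_natCast, ← zpow_natCast, hx', hy', zpow_mul_zpow_zpow hxy, zpow_mul_zpow_zpow hxy,
    zpow_mul_zpow_mul hxy, S.zpow_mul_zpow_iff, ← solve_pair_iff hu, hD]
  push_cast
  simp only [ZMod.natCast_val, ZMod.cast_id', id_eq]

/-- The power relations satisfied by the generators `a ^ i * b ^ j * d`,
`a ^ (k * p ^ (n - m)) * b ^ l * e`, in terms of those satisfied by `a`, `b`. -/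
theorem relations_iff (S : GenSystem p a b c x y) (h2 : 2 < p) {n m : ℕ} (hm : 2 ≤ m)
    (hnm : m ≤ n) {w : Matrix (Fin 2) (Fin 2) (ZMod p)} {v : Fin 2 → ZMod p}
    (ha : a ^ (p ^ n) = x ^ (w 0 0).val * y ^ (w 0 1).val)
    (hb : b ^ (p ^ m) = x ^ (w 1 0).val * y ^ (w 1 1).val)
    (hc : c ^ p = x ^ (v 0).val * y ^ (v 1).val) {i j k l : ℤ} {d e a' b' c' x' y' : G}
    (hd : d ∈ commutator G) (he : e ∈ commutator G) (ha' : a' = a ^ i * b ^ j * d)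
    (hb' : b' = a ^ (k * (p : ℤ) ^ (n - m)) * b ^ l * e) (hc' : c' = pcomm a' b')
    (hx' : x' = pcomm b' c') (hy' : y' = pcomm c' a') {u : ZMod p}
    (hu : u * ((i : ZMod p) * l - j * (k * (p : ZMod p) ^ (n - m))) = 1)
    (w' : Matrix (Fin 2) (Fin 2) (ZMod p)) (v' : Fin 2 → ZMod p) :
    (a' ^ (p ^ n) = x' ^ (w' 0 0).val * y' ^ (w' 0 1).val ∧
      b' ^ (p ^ m) = x' ^ (w' 1 0).val * y' ^ (w' 1 1).val ∧
      c' ^ p = x' ^ (v' 0).val * y' ^ (v' 1).val) ↔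
    (w' = !![u * i, u * j * (p : ZMod p) ^ (n - m); u * k, u * l] * w *
        (!![u * i, u * j; u * k * (p : ZMod p) ^ (n - m), u * l]).transpose ∧
      v' = (!![u * i, u * j; u * k * (p : ZMod p) ^ (n - m), u * l]).mulVec v) := by
  have hp : p.Prime := Fact.out
  have hxy := S.commute_xy
  set q : ℤ := (p : ℤ) ^ (n - m) with hq
  have hqc : (p : ZMod p) ^ (n - m) = (q : ℤ) := by simp [hq]
  obtain ⟨D, hD⟩ : ∃ D, D = i * l - j * (k * q) := ⟨_, rfl⟩
  obtain ⟨-, hcp, hX, hY⟩ := S.change hD hd he ha' hb' hc'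
  rw [← hx'] at hX
  rw [← hy'] at hY
  rw [hqc] at hu ⊢
  have hu' : u * ((i : ZMod p) * l - j * ((k * q : ℤ) : ZMod p)) = 1 := by
    push_cast; exact hu
  have hpq : p ^ n = p ^ m * p ^ (n - m) := by rw [← pow_add, Nat.add_sub_cancel' hnm]
  -- These two identities put q in opposite corners of Y and Y₁: a'^(p^n) involves (b^(p^m))^(jq),
  -- whereas the a-part a^(kq) of b' contributes (a^(p^n))^k to b'^(p^m).
  have hbn : b ^ (p ^ n) = (b ^ (p ^ m)) ^ q := by
    rw [hpq, pow_mul, hq, ← zpow_natCast]; push_cast; rfl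
  have ham : a ^ (p ^ n) = (a ^ (p ^ m)) ^ q := by
    rw [hpq, pow_mul, hq, ← zpow_natCast]; push_cast; rfl
  replace ha : a ^ (p ^ n) = x ^ ((w 0 0).val : ℤ) * y ^ ((w 0 1).val : ℤ) := by
    simpa only [zpow_natCast] using ha
  replace hb : b ^ (p ^ m) = x ^ ((w 1 0).val : ℤ) * y ^ ((w 1 1).val : ℤ) := by
    simpa only [zpow_natCast] using hb
  replace hc : c ^ p = x ^ ((v 0).val : ℤ) * y ^ ((v 1).val : ℤ) := by
    simpa only [zpow_natCast] using hc
  have e1 := S.pow_prime_pow_eq hp h2 (hm.trans hnm) i j hd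
  have e2 := S.pow_prime_pow_eq hp h2 hm (k * q) l he
  rw [← ha', hbn, ha, hb, ← zpow_mul (_ * _) q, zpow_mul_zpow_zpow hxy, zpow_mul_zpow_zpow hxy,
    zpow_mul_zpow_mul hxy] at e1
  rw [← hb', mul_comm k q, zpow_mul _ q k, ← ham, ha, hb, zpow_mul_zpow_zpow hxy, zpow_mul_zpow_zpow hxy,
    zpow_mul_zpow_mul hxy] at e2
  rw [hc, zpow_mul_zpow_zpow hxy] at hcp
  rw [e1, e2, hcp, S.zpow_eq_change_iff hD hX hY hu', S.zpow_eq_change_iff hD hX hY hu',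
    S.zpow_eq_change_iff hD hX hY hu']
  have hDc : ((D : ℤ) : ZMod p) = i * l - j * (k * q) := by rw [hD]; push_cast; rfl
  push_cast
  simp only [ZMod.natCast_val, ZMod.cast_id', id_eq, hDc]
  rw [← Matrix.ext_iff, funext_iff]
  simp only [Fin.forall_fin_two, Matrix.mul_apply, Matrix.mulVec, dotProduct, Fin.sum_univ_two,
    Matrix.transpose_apply, Matrix.of_apply, Matrix.cons_val_zero, Matrix.cons_val_one]
  simp only [and_assoc]
  refine and_congr ?_ (and_congr ?_ (and_congr ?_ (and_congr ?_ (and_congr ?_ ?_)))) <;>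
    refine Eq.congr_right ?_
  · ring
  · ring
  · ring
  · ring
  -- The vector carries an extra factor D from c'^p = (c^p)^D, cancelling one of the two factors u;
  -- hence `hu` is used only here and in the next equation.
  · linear_combination u * (i * v 0 + j * v 1) * hu
  · linear_combination u * (k * q * v 0 + l * v 1) * hu

end GenSystem

/-! ### Consequences of the hypotheses on G. -/

theorem IsCentralExtOfMp.card_G3 {p n m : ℕ} {G : Type*} [Group G]
    (h : IsCentralExtOfMp p n m G) : Nat.card (G3 G) = p ^ 2 := by
  obtain ⟨e⟩ := h.G3_iso
  rw [Nat.card_congr e.toEquiv, Nat.card_prod, Nat.card_congr Multiplicative.toAdd, Nat.card_zmod,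
    sq]

theorem IsCentralExtOfMp.card_eq {p n m : ℕ} {G : Type*} [Group G]
    (h : IsCentralExtOfMp p n m G) : Nat.card G = p ^ 2 * Nat.card (Mp p n m) := by
  obtain ⟨e⟩ := h.quotient_iso
  rw [Subgroup.card_eq_card_quotient_mul_card_subgroup (G3 G), h.card_G3,
    Nat.card_congr e.toEquiv, mul_comm]

theorem IsCentralExtOfMp.pow_eq_one {p n m : ℕ} {G : Type*} [Group G]
    (h : IsCentralExtOfMp p n m G) {z : G} (hz : z ∈ G3 G) : z ^ p = 1 := by
  obtain ⟨e⟩ := h.G3_iso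
  have hq : ∀ q : Multiplicative (ZMod p), q ^ p = 1 := fun q =>
    Multiplicative.toAdd.injective (by rw [toAdd_pow]; simp)
  have h1 : (⟨z, hz⟩ : G3 G) ^ p = 1 := by
    apply e.injective
    rw [map_pow, map_one]
    exact Prod.ext (hq _) (hq _)
  exact congrArg Subtype.val h1

theorem IsCentralExtOfMp.genSystem {p n m : ℕ} {G : Type*} [Group G]
    (h : IsCentralExtOfMp p n m G) {a b c x y : G} (hab : IsCharGenerators p n m a b)
    (hc : c = pcomm a b) (hx : x = pcomm b c) (hy : y = pcomm c a) {s t : ℕ}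
    (hcp : c ^ p = x ^ s * y ^ t) : GenSystem p a b c x y where
  gen := hc ▸ hab.1
  c_eq := hc
  x_eq := hx
  y_eq := hy
  central := h.G3_central
  pow_eq_one _ := h.pow_eq_one
  card_G3 := h.card_G3
  c_pow := by
    have hcm : c ∈ commutator G := hc ▸ pcomm_mem_commutator a b
    rw [hcp, hx, hy]
    exact mul_mem (pow_mem (pcomm_mem_G3_right hcm _) s) (pow_mem (pcomm_mem_G3_left hcm _) t)

/-- The homomorphism from `M_p(n,m,1)` onto the cyclic group of order `p ^ n` that sends `a` to
a generator and `b`, `c` to the identity. -/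
theorem exists_hom_zmod (p n m : ℕ) : ∃ χ : Mp p n m →* Multiplicative (ZMod (p ^ n)),
    χ (PresentedGroup.of 0) = Multiplicative.ofAdd 1 ∧ χ (PresentedGroup.of 1) = 1 := by
  let f : Fin 3 → Multiplicative (ZMod (p ^ n)) := ![Multiplicative.ofAdd 1, 1, 1]
  have hf : ∀ r ∈ MpRels p n m, FreeGroup.lift f r = 1 := by
    have hcomm : ∀ u v : Multiplicative (ZMod (p ^ n)), pcomm u v = 1 := fun u v =>
      pcomm_eq_one_of_commute (Commute.all u v)
    rintro r (rfl | rfl | rfl | rfl | rfl | rfl) <;>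
      simp only [map_pow, map_mul, map_inv, map_pcomm, hcomm, FreeGroup.lift_apply_of]
    · change Multiplicative.ofAdd 1 ^ p ^ n = 1
      rw [← ofAdd_nsmul, nsmul_one, ZMod.natCast_self, ofAdd_zero]
    · exact one_pow _
    · exact one_pow _
    · change 1 * (1 : Multiplicative (ZMod (p ^ n)))⁻¹ = 1
      simp
  exact ⟨PresentedGroup.toGroup hf, PresentedGroup.toGroup.of hf, PresentedGroup.toGroup.of hf⟩

/-- The character of order p^n that detects a and kills b, G' and G₃ sends the given power to k p^m
modulo p^n. -/
theorem IsCharGenerators.pow_dvd {p n m : ℕ} [Fact p.Prime] {G : Type*} [Group G] {a b : G}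
    (hab : IsCharGenerators p n m a b) (hnm : m ≤ n) {k l : ℤ} {e : G} (he : e ∈ commutator G)
    (h : (a ^ k * b ^ l * e) ^ (p ^ m) ∈ G3 G) : (p : ℤ) ^ (n - m) ∣ k := by
  obtain ⟨-, f, hfa, hfb⟩ := hab
  obtain ⟨χ, hχa, hχb⟩ := exists_hom_zmod p n m
  let ψ : G →* Multiplicative (ZMod (p ^ n)) :=
    (χ.comp f.toMonoidHom).comp (QuotientGroup.mk' (G3 G))
  have ha : ψ a = Multiplicative.ofAdd 1 := (congrArg χ hfa).trans hχa
  have hb : ψ b = 1 := (congrArg χ hfb).trans hχb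
  have he' : ψ e = 1 := Abelianization.commutator_subset_ker ψ he
  have h3 : ∀ z ∈ G3 G, ψ z = 1 := fun z hz =>
    (congrArg (fun q => χ (f q)) ((QuotientGroup.eq_one_iff z).2 hz)).trans
      ((congrArg χ (map_one f)).trans (map_one χ))
  have h1 := h3 _ h
  rw [map_pow, map_mul, map_mul, map_zpow, map_zpow, ha, hb, he', one_zpow, mul_one, mul_one,
    ← zpow_natCast, ← zpow_mul, ← ofAdd_zsmul, zsmul_one, ofAdd_eq_one,
    ZMod.intCast_zmod_eq_zero_iff_dvd] at h1
  push_cast at h1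
  rw [← Nat.sub_add_cancel hnm, pow_add] at h1
  have hp0 : (p : ℤ) ^ m ≠ 0 := pow_ne_zero _ (by exact_mod_cast (Fact.out : p.Prime).ne_zero)
  simpa using Int.dvd_of_mul_dvd_mul_right hp0 h1

/-! ### Isomorphism from common relations, and the classification. -/

/-- The subgroup K of G × H generated by (a, a') and (b, b') satisfies the same relations, so its
order is at most |G| = |H|. As K surjects onto both factors, it is the graph of an isomorphism. -/
theorem nonempty_mulEquiv_of_relations {p n m : ℕ} [Fact p.Prime] [Finite (Mp p n m)]
    {G H : Type*} [Group G] [Finite G] [Group H] [Finite H]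
    (hG : Nat.card G = p ^ 2 * Nat.card (Mp p n m)) (hH : Nat.card H = p ^ 2 * Nat.card (Mp p n m))
    {a b c x y : G} (gen : Subgroup.closure {a, b} = ⊤)
    (hc : c = pcomm a b) (hx : x = pcomm b c) (hy : y = pcomm c a)
    (hxc : x ∈ Subgroup.center G) (hyc : y ∈ Subgroup.center G) (hxp : x ^ p = 1)
    (hyp : y ^ p = 1) {a' b' c' x' y' : H} (gen' : Subgroup.closure {a', b'} = ⊤)
    (hc' : c' = pcomm a' b') (hx' : x' = pcomm b' c') (hy' : y' = pcomm c' a')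
    (hxc' : x' ∈ Subgroup.center H) (hyc' : y' ∈ Subgroup.center H) (hxp' : x' ^ p = 1)
    (hyp' : y' ^ p = 1) {s₁ t₁ s₂ t₂ s₃ t₃ : ℤ} (ha : a ^ (p ^ n) = x ^ s₁ * y ^ t₁)
    (hb : b ^ (p ^ m) = x ^ s₂ * y ^ t₂) (hcp : c ^ p = x ^ s₃ * y ^ t₃)
    (ha' : a' ^ (p ^ n) = x' ^ s₁ * y' ^ t₁)
    (hb' : b' ^ (p ^ m) = x' ^ s₂ * y' ^ t₂) (hcp' : c' ^ p = x' ^ s₃ * y' ^ t₃) :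
    Nonempty (G ≃* H) := by
  set K : Subgroup (G × H) := Subgroup.closure {(a, a'), (b, b')} with hK
  let A : K := ⟨(a, a'), Subgroup.subset_closure (by simp)⟩
  let B : K := ⟨(b, b'), Subgroup.subset_closure (by simp)⟩
  let C : K := pcomm A B
  let X : K := pcomm B C
  let Y : K := pcomm C A
  have hC : (C : G × H) = (c, c') := by rw [hc, hc']; rfl
  have hX : (X : G × H) = (x, x') := by
    rw [hx, hx']; exact (map_pcomm K.subtype B C).trans (by rw [K.subtype_apply C, hC]; rfl)
  have hY : (Y : G × H) = (y, y') := by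
    rw [hy, hy']; exact (map_pcomm K.subtype C A).trans (by rw [K.subtype_apply C, hC]; rfl)
  have hgen : Subgroup.closure {A, B} = ⊤ := by
    rw [eq_top_iff, ← Subgroup.closure_closure_coe_preimage (k := {(a, a'), (b, b')})]
    refine Subgroup.closure_mono ?_
    rintro u (hu | hu)
    · exact Or.inl (Subtype.ext hu)
    · exact Or.inr (Subtype.ext hu)
  have hcen : ∀ (Z : K) (z : G) (z' : H), (Z : G × H) = (z, z') → z ∈ Subgroup.center G →
      z' ∈ Subgroup.center H → Z ∈ Subgroup.center K := by
    intro Z z z' hZ hz hz'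
    refine Subgroup.mem_center_iff.mpr fun g => Subtype.ext ?_
    rw [Subgroup.coe_mul, Subgroup.coe_mul, hZ]
    exact Prod.ext (Subgroup.mem_center_iff.mp hz _) (Subgroup.mem_center_iff.mp hz' _)
  have hle := card_le_of_relations (p := p) (n := n) (m := m) (s₁ := s₁) (t₁ := t₁) (s₂ := s₂)
    (t₂ := t₂) (s₃ := s₃) (t₃ := t₃) hgen (rfl : C = _) (rfl : X = _) (rfl : Y = _)
    (hcen X _ _ hX hxc hxc') (hcen Y _ _ hY hyc hyc')
    (Subtype.ext (by rw [Subgroup.coe_pow, hX, Prod.pow_mk, hxp, hxp']; rfl))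
    (Subtype.ext (by rw [Subgroup.coe_pow, hY, Prod.pow_mk, hyp, hyp']; rfl))
    (Subtype.ext (by
      rw [Subgroup.coe_pow, Subgroup.coe_mul, Subgroup.coe_zpow, Subgroup.coe_zpow, hX, hY]
      exact Prod.ext ha ha'))
    (Subtype.ext (by
      rw [Subgroup.coe_pow, Subgroup.coe_mul, Subgroup.coe_zpow, Subgroup.coe_zpow, hX, hY]
      exact Prod.ext hb hb'))
    (Subtype.ext (by
      rw [Subgroup.coe_pow, Subgroup.coe_mul, Subgroup.coe_zpow, Subgroup.coe_zpow, hX, hY, hC]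
      exact Prod.ext hcp hcp'))
  let f : K →* G := (MonoidHom.fst G H).comp K.subtype
  let g : K →* H := (MonoidHom.snd G H).comp K.subtype
  have hf : Function.Surjective f := by
    rw [← MonoidHom.range_eq_top, eq_top_iff, ← gen, Subgroup.closure_le]
    rintro u (rfl | hu)
    · exact ⟨A, rfl⟩
    · rw [Set.mem_singleton_iff.1 hu]; exact ⟨B, rfl⟩
  have hg : Function.Surjective g := by
    rw [← MonoidHom.range_eq_top, eq_top_iff, ← gen', Subgroup.closure_le]
    rintro u (rfl | hu)
    · exact ⟨A, rfl⟩
    · rw [Set.mem_singleton_iff.1 hu]; exact ⟨B, rfl⟩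
  have hfb : Function.Bijective f := (Nat.bijective_iff_surjective_and_card f).2
    ⟨hf, le_antisymm (hG ▸ hle) (Nat.card_le_card_of_surjective f hf)⟩
  have hgb : Function.Bijective g := (Nat.bijective_iff_surjective_and_card g).2
    ⟨hg, le_antisymm (hH ▸ hle) (Nat.card_le_card_of_surjective g hg)⟩
  exact ⟨(MulEquiv.ofBijective f hfb).symm.trans (MulEquiv.ofBijective g hgb)⟩

theorem theorem6p2 (p n m : ℕ) [Fact p.Prime] (hp : 2 < p) (hm : 2 ≤ m) (hnm : m ≤ n)
    (G : Type*) [Group G] [Finite G] (H : Type*) [Group H] [Finite H]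
    (hG : IsCentralExtOfMp p n m G) (hH : IsCentralExtOfMp p n m H)
    (wG wH : Matrix (Fin 2) (Fin 2) (ZMod p)) (vG vH : Fin 2 → ZMod p)
    (hwG : IsCharMatrixVector p n m G wG vG) (hwH : IsCharMatrixVector p n m H wH vH) :
    Nonempty (G ≃* H) ↔
      ∃ (y₁₁ y₁₂ y₂₁ y₂₂ : ZMod p) (Y Y₁ : Matrix (Fin 2) (Fin 2) (ZMod p)),
        Y = !![y₁₁, y₁₂; y₂₁ * (p : ZMod p) ^ (n - m), y₂₂] ∧
        Y₁ = !![y₁₁, y₁₂ * (p : ZMod p) ^ (n - m); y₂₁, y₂₂] ∧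
        IsUnit Y ∧ wH = Y₁ * wG * Y.transpose ∧ vH = Y.mulVec vG := by
  obtain ⟨a, b, c, x, y, hab, hc, hx, hy, ha, hb, hcp⟩ := hwG
  obtain ⟨a', b', c', x', y', hab', hc', hx', hy', ha', hb', hcp'⟩ := hwH
  have S := hG.genSystem hab hc hx hy hcp
  have S' := hH.genSystem hab' hc' hx' hy' hcp'
  have hqc : (((p : ℤ) ^ (n - m) : ℤ) : ZMod p) = (p : ZMod p) ^ (n - m) := by simp
  constructor
  · rintro ⟨φ⟩
    obtain ⟨i, j, d, hd, hA⟩ := S.exists_eq_mul_commutator (φ.symm a')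
    obtain ⟨k₀, l, e, he, hB⟩ := S.exists_eq_mul_commutator (φ.symm b')
    have hC : φ.symm c' = pcomm (φ.symm a') (φ.symm b') := by rw [hc', map_pcomm]
    have hX : φ.symm x' = pcomm (φ.symm b') (φ.symm c') := by rw [hx', map_pcomm]
    have hY : φ.symm y' = pcomm (φ.symm c') (φ.symm a') := by rw [hy', map_pcomm]
    have hA' := congrArg φ.symm ha'
    have hB' := congrArg φ.symm hb'
    have hC' := congrArg φ.symm hcp'
    simp only [map_mul, map_pow] at hA' hB' hC'
    have hCm : φ.symm c' ∈ commutator G := hC ▸ pcomm_mem_commutator _ _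
    have hdvd : (p : ℤ) ^ (n - m) ∣ k₀ := by
      refine hab.pow_dvd hnm (l := l) he ?_
      rw [← hB, hB', hX, hY]
      exact mul_mem (pow_mem (pcomm_mem_G3_right hCm _) _) (pow_mem (pcomm_mem_G3_left hCm _) _)
    obtain ⟨k, rfl⟩ := hdvd
    rw [mul_comm _ k] at hB
    -- If D vanished modulo p, the formula for x' would give x' = 1, against the independence of x'
    -- and y'.
    have hD : ((i : ZMod p) * l - j * (k * (p : ZMod p) ^ (n - m))) ≠ 0 := by
      intro h0
      obtain ⟨-, -, h1, -⟩ := S.change rfl hd he hA hB hC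
      have hD0 : ((i * l - j * (k * (p : ℤ) ^ (n - m)) : ℤ) : ZMod p) = ((0 : ℤ) : ZMod p) := by
        push_cast; rw [h0]
      have h2 : φ.symm x' = x ^ (0 : ℤ) * y ^ (0 : ℤ) := by
        rw [hX, h1]
        refine S.zpow_mul_zpow_congr ?_ ?_
        · rw [Int.cast_mul, hD0]; simp
        · rw [Int.cast_neg, Int.cast_mul, hD0]; simp
      have h3 : x' = 1 := φ.symm.injective (by rw [h2]; simp)
      have h4 := (S'.zpow_mul_zpow_inj (s := 1) (t := 0) (u := 0) (v := 0) (by simp [h3])).1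
      simp at h4
    set δ := (i : ZMod p) * l - j * (k * (p : ZMod p) ^ (n - m)) with hδ
    have hu : δ⁻¹ * δ = 1 := inv_mul_cancel₀ hD
    obtain ⟨hw, hv⟩ := (S.relations_iff hp hm hnm ha hb hcp hd he hA hB hC hX hY hu wH vH).1
      ⟨hA', hB', hC'⟩
    refine ⟨δ⁻¹ * i, δ⁻¹ * j, δ⁻¹ * k, δ⁻¹ * l, _, _, rfl, rfl, ?_, hw, hv⟩
    rw [Matrix.isUnit_iff_isUnit_det, Matrix.det_fin_two_of, isUnit_iff_ne_zero,
      show δ⁻¹ * i * (δ⁻¹ * l) - δ⁻¹ * j * (δ⁻¹ * k * (p : ZMod p) ^ (n - m)) =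
        δ⁻¹ * (δ⁻¹ * δ) by rw [hδ]; ring, hu, mul_one]
    exact inv_ne_zero hD
  · rintro ⟨y₁₁, y₁₂, y₂₁, y₂₂, Y, Y₁, rfl, rfl, hY, hw, hv⟩
    rw [Matrix.isUnit_iff_isUnit_det, Matrix.det_fin_two_of, isUnit_iff_ne_zero] at hY
    obtain ⟨δ, hδ⟩ : ∃ δ, δ = y₁₁ * y₂₂ - y₁₂ * (y₂₁ * (p : ZMod p) ^ (n - m)) := ⟨_, rfl⟩
    rw [← hδ] at hY
    -- With δ = det Y, the exponents are integer lifts of δ⁻¹Y, with the factor q kept apart. This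
    -- matrix has determinant δ⁻¹, so δ plays the role of u.
    have hlift : ∀ z : ZMod p, ∃ i : ℤ, z = δ * i := fun z => by
      obtain ⟨i, hi⟩ := ZMod.intCast_surjective (δ⁻¹ * z)
      exact ⟨i, by rw [hi, mul_inv_cancel_left₀ hY]⟩
    obtain ⟨i, rfl⟩ := hlift y₁₁
    obtain ⟨j, rfl⟩ := hlift y₁₂
    obtain ⟨k, rfl⟩ := hlift y₂₁
    obtain ⟨l, rfl⟩ := hlift y₂₂
    have hu : δ * ((i : ZMod p) * l - j * (k * (p : ZMod p) ^ (n - m))) = 1 := by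
      apply mul_left_cancel₀ hY
      linear_combination -hδ
    have hA : a ^ i * b ^ j = a ^ i * b ^ j * 1 := (mul_one _).symm
    have hB : a ^ (k * (p : ℤ) ^ (n - m)) * b ^ l = a ^ (k * (p : ℤ) ^ (n - m)) * b ^ l * 1 :=
      (mul_one _).symm
    have h1 : (1 : G) ∈ commutator G := one_mem _
    obtain ⟨r1, r2, r3⟩ := (S.relations_iff hp hm hnm ha hb hcp h1 h1 hA hB rfl rfl rfl hu
      wH vH).2 ⟨hw, hv⟩
    have hcop : IsCoprime (i * l - j * (k * (p : ℤ) ^ (n - m))) (p : ℤ) := by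
      rw [isCoprime_comm, ← ZMod.coe_int_isUnit_iff_isCoprime]
      push_cast
      exact IsUnit.of_mul_eq_one δ (by rw [mul_comm]; exact hu)
    have gen := S.closure_pair_eq_top hG.isPGroup rfl hcop h1 h1 hA hB
    have hcop' : IsCoprime ((1 : ℤ) * 1 - 0 * 0) (p : ℤ) := by simpa using isCoprime_one_left
    -- The identity change of generators, used to drop c' from the generating set.
    have gen' := S'.closure_pair_eq_top hH.isPGroup rfl hcop' (one_mem _) (one_mem _)
      (a' := a') (b' := b') (by simp) (by simp)
    obtain ⟨f⟩ := hG.quotient_iso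
    have : Finite (Mp p n m) := Finite.of_equiv _ f.toEquiv
    have hcm := pcomm_mem_commutator (a ^ i * b ^ j) (a ^ (k * (p : ℤ) ^ (n - m)) * b ^ l)
    have hx3 := pcomm_mem_G3_right hcm (a ^ (k * (p : ℤ) ^ (n - m)) * b ^ l)
    have hy3 := pcomm_mem_G3_left hcm (a ^ i * b ^ j)
    simp only [← zpow_natCast _ (ZMod.val _)] at r1 r2 r3 ha' hb' hcp'
    exact nonempty_mulEquiv_of_relations hG.card_eq hH.card_eq gen rfl rfl rfl
      (S.central hx3) (S.central hy3) (S.pow_eq_one _ hx3) (S.pow_eq_one _ hy3) gen'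
      hc' hx' hy' (S'.central S'.x_mem) (S'.central S'.y_mem) (S'.pow_eq_one _ S'.x_mem)
      (S'.pow_eq_one _ S'.y_mem) r1 r2 r3 ha' hb' hcp'
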